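/- Let $n,t\ge 0$ be integers, let $f_1,\dots,f_t\in\mathbb{C}[x_1,\dots,x_n]$ be irreducible and pairwise coprime (i.e. for $i\ne j$ every common divisor of $f_i$ and $f_j$ is a unit), let $a_1,\dots,a_t\ge 1$ be integers, and put $$A=\frac{\mathbb{C}[u,v,x_1,\dots,x_n]}{(uv-f_1^{a_1}\cdots f_t^{a_t})}$$ (an empty product being $1$). Then $A$ is an integral domain that is integrally closed in its field of fractions $Q(A)$, and there is an isomorphism of abelian groups $$\operatorname{Cl}(A)\;\cong\;\mathbb{Z}^{t}/\,\mathbb{Z}\cdot(a_1,\dots,a_t).$$ Here, for a normal noetherian domain $R$ with field of fractions $Q(R)$, let $X_1(R)$ be the set of prime ideals of height one. For $\mathfrak p\in X_1(R)$ the localisation $R_{\mathfrak p}$ is a discrete valuation ring; let $\nu_{\mathfrak p}\colon Q(R)^\times\to\mathbb{Z}$ be its normalised valuation. The divisor class group $\operatorname{Cl}(R)$ is the cokernel of the homomorphism $$\operatorname{div}\colon Q(R)^\times\to\bigoplus_{\mathfrak p\in X_1(R)}\mathbb{Z}\cdot\mathfrak p,\qquad \operatorname{div}(x)=\sum_{\mathfrak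 p\in X_1(R)}\nu_{\mathfrak p}(x)\,\mathfrak p .$$ -/

import Mathlib

/-- The set `X₁(R)` of height one prime ideals of `R`. -/
abbrev HeightOnePrime (R : Type*) [CommRing R] : Type _ :=
  {p : PrimeSpectrum R // p.asIdeal.height = 1}

/-- The group of Weil divisors of `R`: the free abelian group on the height one primes. -/
abbrev WeilDivisor (R : Type*) [CommRing R] : Type _ :=
  HeightOnePrime R →₀ ℤ

/-- The localisation of a normal noetherian domain at a height one prime is a DVR. -/
instance HeightOnePrime.isDiscreteValuationRing {R : Type*} [CommRing R] [IsDomain R]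
    [IsNoetherianRing R] [IsIntegrallyClosed R] (p : HeightOnePrime R) :
    IsDiscreteValuationRing (Localization.AtPrime p.1.asIdeal) := by
  have hdom : IsDomain (Localization.AtPrime p.1.asIdeal) := inferInstance
  have hnoeth : IsNoetherianRing (Localization.AtPrime p.1.asIdeal) :=
    IsLocalization.isNoetherianRing p.1.asIdeal.primeCompl _ inferInstance
  have hic : IsIntegrallyClosed (Localization.AtPrime p.1.asIdeal) :=
    isIntegrallyClosed_of_isLocalization _ p.1.asIdeal.primeCompl
      p.1.asIdeal.primeCompl_le_nonZeroDivisors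
  have hdim : ringKrullDim (Localization.AtPrime p.1.asIdeal) = 1 := by
    rw [IsLocalization.AtPrime.ringKrullDim_eq_height p.1.asIdeal, p.2]
    rfl
  have hle : Ring.DimensionLEOne (Localization.AtPrime p.1.asIdeal) := by
    refine ⟨fun {q} hq0 hq => Ideal.isMaximal_of_height_eq_ringKrullDim ?_⟩
    have h1 := Ideal.height_le_ringKrullDim_of_isPrime (I := q)
    rw [hdim] at h1 ⊢
    have h2 : q.height ≠ 0 := fun h => hq0 (Ideal.height_eq_zero_iff_eq_bot.1 h)
    have h3 : q.height ≤ 1 := by exact_mod_cast h1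
    have h4 : q.height = 1 := le_antisymm h3 (Order.one_le_iff_pos.2 (pos_iff_ne_zero.2 h2))
    rw [h4]
    rfl
  have hfield : ¬ IsField (Localization.AtPrime p.1.asIdeal) := by
    intro h
    have := ringKrullDim_eq_zero_of_isField h
    rw [hdim] at this
    exact one_ne_zero this
  have hded : IsDedekindDomain (Localization.AtPrime p.1.asIdeal) := { }
  exact ((IsDiscreteValuationRing.TFAE _ hfield).out 0 2).2 hded

/-- The normalised discrete valuation `ν_p : Q(R)ˣ → ℤ` of the DVR `R_p`, for `p` a height one prime
of a normal noetherian domain `R`. (Mathlib's valuation is multiplicative and takes the value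
`exp (-1)` on a uniformiser, whence the sign.) -/
noncomputable def HeightOnePrime.val {R : Type*} [CommRing R] [IsDomain R]
    [IsNoetherianRing R] [IsIntegrallyClosed R] (p : HeightOnePrime R)
    (x : (FractionRing R)ˣ) : ℤ :=
  -WithZero.log ((IsDiscreteValuationRing.maximalIdeal
    (Localization.AtPrime p.1.asIdeal)).valuation (FractionRing R) (x : FractionRing R))

theorem HeightOnePrime.val_mul {R : Type*} [CommRing R] [IsDomain R]
    [IsNoetherianRing R] [IsIntegrallyClosed R] (p : HeightOnePrime R)
    (x y : (FractionRing R)ˣ) : p.val (x * y) = p.val x + p.val y := by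
  unfold HeightOnePrime.val
  rw [Units.val_mul, map_mul, WithZero.log_mul, neg_add]
  · simp
  · simp

/-- A nonzero `r ∈ R` outside `p` has valuation zero at `p`. -/
theorem HeightOnePrime.val_eq_zero {R : Type*} [CommRing R] [IsDomain R]
    [IsNoetherianRing R] [IsIntegrallyClosed R] (p : HeightOnePrime R)
    (x : (FractionRing R)ˣ) (r : R) (hx : (x : FractionRing R) = algebraMap R (FractionRing R) r)
    (hr : r ∉ p.1.asIdeal) : p.val x = 0 := by
  unfold HeightOnePrime.val
  rw [hx, IsScalarTower.algebraMap_apply R (Localization.AtPrime p.1.asIdeal) (FractionRing R),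
    (IsDedekindDomain.HeightOneSpectrum.valuation_eq_one_iff_notMem _).2]
  · simp
  · have h : IsUnit (algebraMap R (Localization.AtPrime p.1.asIdeal) r) :=
      IsLocalization.map_units (M := p.1.asIdeal.primeCompl) _ ⟨r, hr⟩
    intro h'
    exact (IsLocalRing.mem_maximalIdeal _).1 h' h

/-- Only finitely many height one primes contain a given nonzero element. -/
theorem HeightOnePrime.finite_mem {R : Type*} [CommRing R] [IsDomain R]
    [IsNoetherianRing R] {r : R} (hr : r ≠ 0) :
    {p : HeightOnePrime R | r ∈ p.1.asIdeal}.Finite := by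
  refine Set.Finite.of_finite_image (f := fun p : HeightOnePrime R => p.1.asIdeal) ?_ ?_
  · refine ((Ideal.span {r}).finite_minimalPrimes_of_isNoetherianRing R).subset ?_
    rintro _ ⟨p, hp, rfl⟩
    have hfin : p.1.asIdeal.FiniteHeight := inferInstance
    refine Ideal.mem_minimalPrimes_of_height_le
      ((Ideal.span_singleton_le_iff_mem _).2 hp) ?_
    rw [p.2]
    exact Ideal.one_le_height_span_singleton_of_mem_nonZeroDivisors
      (mem_nonZeroDivisors_of_ne_zero hr)
  · intro p _ q _ h
    exact Subtype.ext (PrimeSpectrum.ext h)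

theorem HeightOnePrime.finite_val_ne_zero {R : Type*} [CommRing R] [IsDomain R]
    [IsNoetherianRing R] [IsIntegrallyClosed R] (x : (FractionRing R)ˣ) :
    {p : HeightOnePrime R | p.val x ≠ 0}.Finite := by
  obtain ⟨a, b, hb, hab⟩ := IsFractionRing.div_surjective (A := R) (x : FractionRing R)
  have hb0 : b ≠ 0 := nonZeroDivisors.ne_zero hb
  have ha0 : a ≠ 0 := by
    rintro rfl
    exact x.ne_zero (by rw [← hab]; simp)
  have inj : ∀ {c : R}, c ≠ 0 → algebraMap R (FractionRing R) c ≠ 0 := fun h =>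
    (map_ne_zero_iff _ (IsFractionRing.injective R (FractionRing R))).2 h
  refine ((HeightOnePrime.finite_mem ha0).union (HeightOnePrime.finite_mem hb0)).subset ?_
  intro p hp
  by_contra hmem
  simp only [Set.mem_union, Set.mem_ofPred_eq, not_or] at hmem
  refine hp ?_
  have h1 := p.val_eq_zero (Units.mk0 _ (inj ha0)) a rfl hmem.1
  have h2 := p.val_eq_zero (Units.mk0 _ (inj hb0)) b rfl hmem.2
  have h3 : x * Units.mk0 _ (inj hb0) = Units.mk0 _ (inj ha0) := by
    ext
    rw [Units.val_mul, ← hab]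
    simp [inj hb0]
  have h4 := p.val_mul x (Units.mk0 _ (inj hb0))
  rw [h3, h1, h2] at h4
  omega

/-- The homomorphism `div : Q(R)ˣ → Div(R)`, `x ↦ ∑ ν_p(x) p`, for a normal noetherian domain. -/
noncomputable def principalDivisor (R : Type*) [CommRing R] [IsDomain R]
    [IsNoetherianRing R] [IsIntegrallyClosed R] :
    Additive (FractionRing R)ˣ →+ WeilDivisor R :=
  AddMonoidHom.mk'
    (fun x => Finsupp.ofSupportFinite (fun p : HeightOnePrime R => p.val x.toMul)
      (HeightOnePrime.finite_val_ne_zero x.toMul))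
    (fun x y => Finsupp.ext fun p => p.val_mul x.toMul y.toMul)

/-- The divisor class group `Cl(R)` of a normal noetherian domain: the cokernel of `div`. -/
abbrev DivisorClassGroup (R : Type*) [CommRing R] [IsDomain R]
    [IsNoetherianRing R] [IsIntegrallyClosed R] : Type _ :=
  WeilDivisor R ⧸ (principalDivisor R).range

/-- The ring `ℂ[u, v, x₁, …, xₙ] / (u v - f₁^{a₁} ⋯ f_t^{a_t})`. The variables `u`, `v`, `x_i` are
`X (inl 0)`, `X (inl 1)`, `X (inr i)`. -/
abbrev HypersurfaceRing (n t : ℕ) (f : Fin t → MvPolynomial (Fin n) ℂ) (a : Fin t → ℕ) : Type :=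
  MvPolynomial (Fin 2 ⊕ Fin n) ℂ ⧸
    Ideal.span {(MvPolynomial.X (Sum.inl 0) * MvPolynomial.X (Sum.inl 1) -
      MvPolynomial.rename Sum.inr (∏ i, f i ^ a i) : MvPolynomial (Fin 2 ⊕ Fin n) ℂ)}

/-!
Write `R = ℂ[x₁, …, xₙ]`, `g = ∏ f i ^ a i` and `A = R[u, v] / (u v - g)`. The argument only uses that
`R` is a factorial domain, that `A` is noetherian and that the `f i` are pairwise non-associated
primes; `IsHyperbola` records what is needed of `A` as an `R`-algebra with two marked elements.

Inverting `u` eliminates `v = g / u`, so `A_u` is the Laurent polynomial ring `R[u, u⁻¹]`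
(`IsHyperbola.isLocalization_away`): it is factorial and its units are `c uᵏ` with `c` a unit of
`R`. By symmetry the same holds for `A_v`. Modulo `u` the ring `A` becomes `(R/g)[v]`, in which `v`
is a nonzerodivisor; hence `A = A_u ∩ A_v`, and `A` is normal because both charts are
(`isIntegrallyClosed_of_away`).

For the class group, Nagata's argument (`nonempty_divisorClassGroup_equiv_of_away`) applies to the
factorial ring `A_u`. A height one prime `Q` not containing `u` extends to a principal prime of
`A_u`, so the class of `Q` is a combination of the classes of primes containing `u`. A principal
divisor supported on the primes containing `u` is the divisor of a unit of `A_u`, hence a multiple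
of `div u`. So `Cl A` is free on the height one primes containing `u`, modulo `div u`. Those primes
are the ideals `P i = (u, f i)`, with `A / P i = (R / f i)[v]`
(`IsHyperbola.exists_heightOnePrime`). At `P i` the elements `v` and `f j`, `j ≠ i`, are units and
`f i` is a uniformiser, so `u v = ∏ f j ^ a j` gives `div u = ∑ a i P i`.
-/

/-! ### Divisors of elements -/

section ElementDivisor

variable {A : Type*} [CommRing A]

theorem HeightOnePrime.eq_of_le [IsNoetherianRing A] {p q : HeightOnePrime A}
    (h : p.1.asIdeal ≤ q.1.asIdeal) : p = q := by
  refine Subtype.ext (PrimeSpectrum.ext (Ideal.eq_of_le_of_height_le _ h ?_))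
  rw [p.2, q.2]

variable [IsDomain A] [IsNoetherianRing A] [IsIntegrallyClosed A]

theorem HeightOnePrime.val_pos (p : HeightOnePrime A) (x : (FractionRing A)ˣ) (r : A)
    (hx : (x : FractionRing A) = algebraMap A (FractionRing A) r) (hr : r ∈ p.1.asIdeal) :
    0 < p.val x := by
  have hne := x.ne_zero
  unfold HeightOnePrime.val
  rw [hx] at hne ⊢
  rw [IsScalarTower.algebraMap_apply A (Localization.AtPrime p.1.asIdeal) (FractionRing A)] at hne ⊢
  have hmem : algebraMap A (Localization.AtPrime p.1.asIdeal) r ∈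
      (IsDiscreteValuationRing.maximalIdeal (Localization.AtPrime p.1.asIdeal)).asIdeal :=
    (IsLocalization.AtPrime.to_map_mem_maximal_iff _ p.1.asIdeal r).2 hr
  have h := ((IsDiscreteValuationRing.maximalIdeal
    (Localization.AtPrime p.1.asIdeal)).valuation_lt_one_iff_mem (K := FractionRing A) _).2 hmem
  rw [neg_pos, WithZero.log_lt_iff_lt_exp (by simpa using hne)]
  simpa using h

/-- If `r ∈ p` divides every element of `p` up to a factor outside `p`, then `r` generates the
maximal ideal of the localisation at `p`, so its valuation is one. -/
theorem HeightOnePrime.val_eq_one (p : HeightOnePrime A) (x : (FractionRing A)ˣ) (r : A)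
    (hx : (x : FractionRing A) = algebraMap A (FractionRing A) r) (hr : r ∈ p.1.asIdeal)
    (h : ∀ y ∈ p.1.asIdeal, ∃ s ∉ p.1.asIdeal, r ∣ s * y) :
    p.val x = 1 := by
  have hne := x.ne_zero
  unfold HeightOnePrime.val
  rw [hx] at hne ⊢
  rw [IsScalarTower.algebraMap_apply A (Localization.AtPrime p.1.asIdeal) (FractionRing A)] at hne ⊢
  have hgen : (IsDiscreteValuationRing.maximalIdeal (Localization.AtPrime p.1.asIdeal)).asIdeal =
      Ideal.span {algebraMap A (Localization.AtPrime p.1.asIdeal) r} := by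
    change IsLocalRing.maximalIdeal _ = _
    rw [← Localization.AtPrime.map_eq_maximalIdeal]
    refine le_antisymm (Ideal.map_le_iff_le_comap.2 fun y hy => ?_) ?_
    · obtain ⟨s, hs, c, hc⟩ := h y hy
      have hsu : IsUnit (algebraMap A (Localization.AtPrime p.1.asIdeal) s) :=
        IsLocalization.map_units (M := p.1.asIdeal.primeCompl) _ ⟨s, hs⟩
      rw [Ideal.mem_comap, Ideal.mem_span_singleton, ← hsu.dvd_mul_left, ← map_mul, hc, map_mul]
      exact dvd_mul_right _ _
    · rw [Ideal.span_singleton_le_iff_mem]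
      exact Ideal.mem_map_of_mem _ hr
  rw [IsDedekindDomain.HeightOneSpectrum.valuation_of_algebraMap,
    IsDedekindDomain.HeightOneSpectrum.intValuation_singleton _ (by rintro h0; simp [h0] at hne)
      hgen]
  simp

open Classical in
/-- The divisor of an element `r` of a normal noetherian domain, with the value `0` at `r = 0`. -/
noncomputable def elementDivisor (r : A) : WeilDivisor A :=
  if hr : r = 0 then 0
  else principalDivisor A (Additive.ofMul (Units.mk0 (algebraMap A (FractionRing A) r)
    ((map_ne_zero_iff _ (IsFractionRing.injective A (FractionRing A))).2 hr)))

theorem elementDivisor_apply {r : A} (hr : r ≠ 0) (p : HeightOnePrime A) :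
    elementDivisor r p = p.val (Units.mk0 (algebraMap A (FractionRing A) r)
    ((map_ne_zero_iff _ (IsFractionRing.injective A (FractionRing A))).2 hr)) := by
  rw [elementDivisor, dif_neg hr]
  rfl

theorem elementDivisor_mem_range (r : A) : elementDivisor r ∈ (principalDivisor A).range := by
  rw [elementDivisor]
  split_ifs
  · exact zero_mem _
  · exact ⟨_, rfl⟩

theorem elementDivisor_mul {r s : A} (hr : r ≠ 0) (hs : s ≠ 0) :
    elementDivisor (r * s) = elementDivisor r + elementDivisor s := by
  ext p
  rw [Finsupp.add_apply, elementDivisor_apply hr, elementDivisor_apply hs,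
    elementDivisor_apply (mul_ne_zero hr hs), ← p.val_mul]
  congr 1
  ext
  simp

theorem elementDivisor_apply_eq_zero {r : A} {p : HeightOnePrime A} (h : r ∉ p.1.asIdeal) :
    elementDivisor r p = 0 := by
  have hr : r ≠ 0 := by
    rintro rfl
    exact h (zero_mem _)
  rw [elementDivisor_apply hr]
  exact p.val_eq_zero _ r rfl h

theorem elementDivisor_apply_pos {r : A} {p : HeightOnePrime A} (hr : r ≠ 0)
    (h : r ∈ p.1.asIdeal) : 0 < elementDivisor r p := by
  rw [elementDivisor_apply hr]
  exact p.val_pos _ r rfl h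

theorem elementDivisor_apply_eq_one {r : A} {p : HeightOnePrime A} (hr : r ≠ 0)
    (h : r ∈ p.1.asIdeal) (hp : ∀ y ∈ p.1.asIdeal, ∃ s ∉ p.1.asIdeal, r ∣ s * y) :
    elementDivisor r p = 1 := by
  rw [elementDivisor_apply hr]
  exact p.val_eq_one _ r rfl h hp

theorem elementDivisor_of_isUnit {r : A} (h : IsUnit r) : elementDivisor r = 0 := by
  ext p
  exact elementDivisor_apply_eq_zero fun hr => p.1.2.ne_top (Ideal.eq_top_of_isUnit_mem _ hr h)

theorem elementDivisor_pow {r : A} (hr : r ≠ 0) (k : ℕ) :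
    elementDivisor (r ^ k) = k • elementDivisor r := by
  induction k with
  | zero => simpa using elementDivisor_of_isUnit isUnit_one
  | succ k ih => rw [pow_succ, elementDivisor_mul (pow_ne_zero _ hr) hr, ih, succ_nsmul]

theorem elementDivisor_prod {ι : Type*} (s : Finset ι) (r : ι → A) (hr : ∀ i ∈ s, r i ≠ 0) :
    elementDivisor (∏ i ∈ s, r i) = ∑ i ∈ s, elementDivisor (r i) := by
  classical
  induction s using Finset.induction_on with
  | empty => simpa using elementDivisor_of_isUnit isUnit_one
  | insert i s hi ih =>
    rw [Finset.prod_insert hi, Finset.sum_insert hi, elementDivisor_mul (hr i (by simp))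
      (Finset.prod_ne_zero_iff.2 fun j hj => hr j (by simp [hj])),
      ih fun j hj => hr j (by simp [hj])]

theorem exists_elementDivisor_sub_of_mem_range {D : WeilDivisor A}
    (hD : D ∈ (principalDivisor A).range) :
    ∃ r s : A, r ≠ 0 ∧ s ≠ 0 ∧ D = elementDivisor r - elementDivisor s := by
  obtain ⟨x, rfl⟩ := hD
  obtain ⟨r, s, hs, hrs⟩ := IsFractionRing.div_surjective (A := A) (x.toMul : FractionRing A)
  have hs0 : s ≠ 0 := nonZeroDivisors.ne_zero hs
  have hr0 : r ≠ 0 := by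
    rintro rfl
    exact x.toMul.ne_zero (by rw [← hrs]; simp)
  refine ⟨r, s, hr0, hs0, eq_sub_of_add_eq ?_⟩
  rw [elementDivisor, elementDivisor, dif_neg hr0, dif_neg hs0, ← map_add]
  congr 1
  refine Additive.toMul.injective (Units.ext ?_)
  rw [toMul_add, toMul_ofMul, toMul_ofMul, Units.val_mul, ← hrs]
  simp [hs0]

end ElementDivisor

/-! ### The class group when `A_u` is factorial -/

section Nagata

variable {A : Type*} [CommRing A] {u : A}

/-- A prime element of `A_u` cuts out a height one prime of `A` that does not contain `u`. -/
theorem exists_heightOnePrime_of_prime_away [IsDomain A] [IsNoetherianRing A]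
    (hu : u ≠ 0) {π : Localization.Away u} (hπ : Prime π) :
    ∃ Q : HeightOnePrime A, u ∉ Q.1.asIdeal ∧
      ∀ x, x ∈ Q.1.asIdeal ↔ π ∣ algebraMap A (Localization.Away u) x := by
  have : IsDomain (Localization.Away u) :=
    IsLocalization.isDomain_localization (powers_le_nonZeroDivisors_of_noZeroDivisors hu)
  have : IsNoetherianRing (Localization.Away u) :=
    IsLocalization.isNoetherianRing (.powers u) _ inferInstance
  have hprime : (Ideal.span {π}).IsPrime :=
    (Ideal.span_singleton_prime hπ.ne_zero).2 hπ
  have hheight : (Ideal.span {π}).height = 1 :=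
    Ideal.height_span_singleton_eq_one_of_mem_nonZeroDivisors
      (mem_nonZeroDivisors_of_ne_zero hπ.ne_zero) hπ.not_isUnit
  refine ⟨⟨⟨(Ideal.span {π}).under A, inferInstance⟩, ?_⟩, fun h => ?_, fun x => ?_⟩
  · rw [IsLocalization.height_under (.powers u), hheight]
  · refine hprime.ne_top (Ideal.eq_top_of_isUnit_mem _ h ?_)
    exact IsLocalization.Away.algebraMap_isUnit u
  · exact Ideal.mem_span_singleton

theorem algebraMap_away_injective [IsDomain A] (hu : u ≠ 0) :
    Function.Injective (algebraMap A (Localization.Away u)) :=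
  IsLocalization.injective _ (powers_le_nonZeroDivisors_of_noZeroDivisors hu)

/-- Every element of `A_u` is associated to the image of an element of `A`. -/
theorem exists_associated_algebraMap_away (y : Localization.Away u) :
    ∃ r : A, Associated y (algebraMap A (Localization.Away u) r) := by
  obtain ⟨⟨r, s⟩, h⟩ := IsLocalization.surj (.powers u) y
  exact ⟨r, (IsLocalization.map_units _ s).unit, h⟩

variable [IsDomain A] [IsNoetherianRing A] [IsIntegrallyClosed A]

/-- If `A_u` is factorial, every height one prime `Q` of `A` not containing `u` is, up to primes
containing `u`, the divisor of an element of `A`. -/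
theorem exists_elementDivisor_eq_single_away (hu : u ≠ 0)
    [UniqueFactorizationMonoid (Localization.Away u)] (Q : HeightOnePrime A)
    (hQ : u ∉ Q.1.asIdeal) :
    ∃ r : A, elementDivisor r Q = 1 ∧
      ∀ Q' : HeightOnePrime A, u ∉ Q'.1.asIdeal → Q' ≠ Q → elementDivisor r Q' = 0 := by
  have hdisj : Disjoint (Submonoid.powers u : Set A) Q.1.asIdeal :=
    (Ideal.disjoint_powers_iff_notMem_of_isPrime u).2 hQ
  have hprime := IsLocalization.isPrime_of_isPrime_disjoint (.powers u) (Localization.Away u)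
    Q.1.asIdeal Q.1.2 hdisj
  have hunder := IsLocalization.under_map_of_isPrime_disjoint (.powers u) (Localization.Away u)
    Q.1.2 hdisj
  have hbot : Q.1.asIdeal.map (algebraMap A (Localization.Away u)) ≠ ⊥ := by
    intro h
    rw [Ideal.map_eq_bot_iff_of_injective (algebraMap_away_injective hu)] at h
    exact Ideal.ne_bot_of_height_eq_one Q.2 h
  obtain ⟨π, hπQ, hπ⟩ := hprime.exists_mem_prime_of_ne_bot hbot
  obtain ⟨Q₁, hQ₁, hmem⟩ := exists_heightOnePrime_of_prime_away hu hπ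
  obtain rfl : Q₁ = Q := by
    refine HeightOnePrime.eq_of_le fun x hx => ?_
    rw [← hunder, Ideal.under_def, Ideal.mem_comap]
    exact Ideal.mem_of_dvd _ ((hmem x).1 hx) hπQ
  obtain ⟨r, hr⟩ := exists_associated_algebraMap_away π
  have hrQ : r ∈ Q₁.1.asIdeal := (hmem r).2 hr.dvd
  have hr0 : r ≠ 0 := by
    rintro rfl
    rw [map_zero, associated_zero_iff_eq_zero] at hr
    exact hπ.ne_zero hr
  -- Clearing denominators, membership in the prime means divisibility by `r` up to a power of `u`.
  have hdvd : ∀ y ∈ Q₁.1.asIdeal, ∃ k : ℕ, r ∣ u ^ k * y := by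
    intro y hy
    obtain ⟨z, hz⟩ := hr.dvd'.trans ((hmem y).1 hy)
    obtain ⟨⟨w, ⟨_, k, rfl⟩⟩, hw⟩ := IsLocalization.surj (.powers u) z
    refine ⟨k, w, algebraMap_away_injective hu ?_⟩
    simp only at hw
    rw [map_mul, map_mul, hz, ← hw]
    ring
  refine ⟨r, elementDivisor_apply_eq_one hr0 hrQ fun y hy => ?_, fun Q' hQ' hne => ?_⟩
  · obtain ⟨k, hk⟩ := hdvd y hy
    exact ⟨u ^ k, fun h => hQ (Q₁.1.2.mem_of_pow_mem _ h), hk⟩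
  · refine elementDivisor_apply_eq_zero fun h =>
      hne (Eq.symm (HeightOnePrime.eq_of_le fun y hy => ?_))
    obtain ⟨k, hk⟩ := hdvd y hy
    exact (Q'.1.2.mem_or_mem (Ideal.mem_of_dvd _ hk h)).resolve_left
      fun h => hQ' (Q'.1.2.mem_of_pow_mem _ h)

/-- If `A_u` is factorial, a fraction whose divisor is supported on primes containing `u` is a
unit of `A_u`, since a prime factor of its reduced numerator or denominator in `A_u` would cut out
a height one prime in the support. Here the unit is the fraction `r' / s'`. -/
theorem exists_isUnit_away_of_elementDivisor_eq (hu : u ≠ 0)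
    [UniqueFactorizationMonoid (Localization.Away u)] {r s : A} (hr : r ≠ 0) (hs : s ≠ 0)
    (h : ∀ Q : HeightOnePrime A, u ∉ Q.1.asIdeal → elementDivisor r Q = elementDivisor s Q) :
    ∃ r' s' : A, IsUnit (algebraMap A (Localization.Away u) r') ∧
      IsUnit (algebraMap A (Localization.Away u) s') ∧ r * s' = s * r' := by
  have : IsDomain (Localization.Away u) :=
    IsLocalization.isDomain_localization (powers_le_nonZeroDivisors_of_noZeroDivisors hu)
  have hinj := algebraMap_away_injective hu
  have hrL : algebraMap A (Localization.Away u) r ≠ 0 := (map_ne_zero_iff _ hinj).2 hr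
  obtain ⟨p, q, c, hpq, hp, hq⟩ :=
    UniqueFactorizationMonoid.exists_reduced_factors _ hrL (algebraMap A (Localization.Away u) s)
  obtain ⟨⟨r₁, ⟨_, k, rfl⟩⟩, hr₁⟩ := IsLocalization.surj (.powers u) p
  obtain ⟨⟨s₁, ⟨_, m, rfl⟩⟩, hs₁⟩ := IsLocalization.surj (.powers u) q
  simp only at hr₁ hs₁
  have hk : IsUnit (algebraMap A (Localization.Away u) (u ^ k)) :=
    IsLocalization.map_units _ (⟨u ^ k, k, rfl⟩ : Submonoid.powers u)
  have hm : IsUnit (algebraMap A (Localization.Away u) (u ^ m)) :=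
    IsLocalization.map_units _ (⟨u ^ m, m, rfl⟩ : Submonoid.powers u)
  have hp0 : p ≠ 0 := by
    rintro rfl
    exact hrL (by rw [← hp, mul_zero])
  have hq0 : q ≠ 0 := by
    rintro rfl
    exact (map_ne_zero_iff _ hinj).2 hs (by rw [← hq, mul_zero])
  have hpr : Associated p (algebraMap A _ (r₁ * u ^ m)) :=
    ⟨(hk.mul hm).unit, by rw [IsUnit.unit_spec, map_mul, ← hr₁]; ring⟩
  have hqs : Associated q (algebraMap A _ (s₁ * u ^ k)) :=
    ⟨(hk.mul hm).unit, by rw [IsUnit.unit_spec, map_mul, ← hs₁]; ring⟩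
  have heq : r * (s₁ * u ^ k) = s * (r₁ * u ^ m) := by
    apply hinj
    simp only [map_mul, ← hr₁, ← hs₁, ← hp, ← hq]
    ring
  generalize r₁ * u ^ m = r' at hpr heq
  generalize s₁ * u ^ k = s' at hqs heq
  have hr'0 : r' ≠ 0 := fun h0 => hp0 (by simpa [h0] using hpr)
  have hs'0 : s' ≠ 0 := fun h0 => hq0 (by simpa [h0] using hqs)
  -- A prime factor of `p` or of `q` would give a height one prime where the divisors differ.
  have key : ∀ π, Prime π → (π ∣ p ↔ π ∣ q) := by
    intro π hπ
    obtain ⟨Q, hQ, hmem⟩ := exists_heightOnePrime_of_prime_away hu hπ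
    rw [hpr.dvd_iff_dvd_right, hqs.dvd_iff_dvd_right, ← hmem, ← hmem]
    have h1 := congrArg (fun D => D Q) (congrArg elementDivisor heq)
    simp only [elementDivisor_mul hr hs'0, elementDivisor_mul hs hr'0, Finsupp.add_apply, h Q hQ,
      add_right_inj] at h1
    constructor
    · intro hmem'
      by_contra hcon
      rw [elementDivisor_apply_eq_zero hcon] at h1
      exact (elementDivisor_apply_pos hr'0 hmem').ne h1
    · intro hmem'
      by_contra hcon
      rw [elementDivisor_apply_eq_zero hcon] at h1
      exact (elementDivisor_apply_pos hs'0 hmem').ne' h1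
  refine ⟨r', s', hpr.isUnit_iff.1 ?_, hqs.isUnit_iff.1 ?_, heq⟩
  · by_contra hcon
    obtain ⟨π, hπ, hdvd⟩ := WfDvdMonoid.exists_irreducible_factor hcon hp0
    exact hπ.not_isUnit (hpq hdvd ((key π hπ.prime).1 hdvd))
  · by_contra hcon
    obtain ⟨π, hπ, hdvd⟩ := WfDvdMonoid.exists_irreducible_factor hcon hq0
    exact hπ.not_isUnit (hpq ((key π hπ.prime).2 hdvd) hdvd)

/-- A form of Nagata's theorem: if `A_u` is factorial and its units are, up to powers of `u`, units
of `A`, then the class group of `A` is generated by the primes containing `u`, with the divisor of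
`u` as the only relation. -/
theorem nonempty_divisorClassGroup_equiv_of_away (hu : u ≠ 0)
    [UniqueFactorizationMonoid (Localization.Away u)]
    (hunits : ∀ r : A, IsUnit (algebraMap A (Localization.Away u) r) →
      ∃ (c : A) (k m : ℕ), IsUnit c ∧ r * u ^ k = c * u ^ m)
    {ι : Type*} [Fintype ι] {P : ι → HeightOnePrime A} (hinj : Function.Injective P)
    (hP : ∀ Q : HeightOnePrime A, u ∈ Q.1.asIdeal ↔ Q ∈ Set.range P)
    {a : ι → ℤ} (ha : ∀ i, elementDivisor u (P i) = a i) :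
    Nonempty (DivisorClassGroup A ≃+ ((ι → ℤ) ⧸ AddSubgroup.zmultiples a)) := by
  classical
  -- The Weil divisors supported on the primes containing `u`.
  let E : (ι → ℤ) →+ WeilDivisor A :=
    (Finsupp.mapDomain.addMonoidHom P).comp
      (Finsupp.linearEquivFunOnFinite ℤ ℤ ι).symm.toLinearMap.toAddMonoidHom
  have hE : ∀ c i, E c (P i) = c i := fun c i => Finsupp.mapDomain_apply hinj _ _
  have hE' : ∀ c Q, u ∉ Q.1.asIdeal → E c Q = 0 := fun c Q hQ =>
    Finsupp.mapDomain_of_notMem_range _ _ fun h => hQ ((hP Q).2 h)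
  have hdiv : ∀ D : WeilDivisor A, (∀ Q, u ∉ Q.1.asIdeal → D Q = 0) → D = E fun i => D (P i) := by
    intro D hD
    ext Q
    by_cases hQ : u ∈ Q.1.asIdeal
    · obtain ⟨i, rfl⟩ := (hP Q).1 hQ
      rw [hE]
    · rw [hD Q hQ, hE' _ Q hQ]
  have hEa : elementDivisor u = E a := by
    rw [hdiv (elementDivisor u) fun Q hQ => elementDivisor_apply_eq_zero hQ]
    exact congrArg E (funext ha)
  let Θ : (ι → ℤ) →+ DivisorClassGroup A := (QuotientAddGroup.mk' _).comp E
  have hsurj : Function.Surjective Θ := by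
    rw [← AddMonoidHom.range_eq_top, eq_top_iff]
    rintro x -
    induction x using QuotientAddGroup.induction_on with | H D =>
    induction D using Finsupp.induction_linear with
    | zero => exact zero_mem _
    | add D₁ D₂ h₁ h₂ => exact add_mem h₁ h₂
    | single Q z =>
      have hz : (Finsupp.single Q z : WeilDivisor A) = z • Finsupp.single Q 1 := by simp
      rw [hz, QuotientAddGroup.mk_zsmul]
      refine zsmul_mem ?_ z
      by_cases hQ : u ∈ Q.1.asIdeal
      · refine ⟨_, (congrArg _ (hdiv (Finsupp.single Q 1) fun Q' hQ' => ?_)).symm⟩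
        exact Finsupp.single_eq_of_ne fun h => hQ' (h ▸ hQ)
      · obtain ⟨r, hr1, hr⟩ := exists_elementDivisor_eq_single_away hu Q hQ
        have h1 : ((Finsupp.single Q 1 : WeilDivisor A) : DivisorClassGroup A) =
            ((Finsupp.single Q 1 - elementDivisor r : WeilDivisor A) : DivisorClassGroup A) := by
          rw [QuotientAddGroup.eq]
          convert neg_mem (elementDivisor_mem_range r) using 1
          abel
        rw [h1]
        refine ⟨_, (congrArg _ (hdiv (Finsupp.single Q 1 - elementDivisor r)
          fun Q' hQ' => ?_)).symm⟩
        by_cases hne : Q' = Q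
        · rw [hne, Finsupp.sub_apply, Finsupp.single_eq_same, hr1, sub_self]
        · rw [Finsupp.sub_apply, Finsupp.single_eq_of_ne hne, hr Q' hQ' hne, sub_self]
  have hker : Θ.ker = AddSubgroup.zmultiples a := by
    refine le_antisymm (fun c hc => ?_) ?_
    · have hc' : E c ∈ (principalDivisor A).range := (QuotientAddGroup.eq_zero_iff _).1 hc
      obtain ⟨r, s, hr, hs, hrs⟩ := exists_elementDivisor_sub_of_mem_range hc'
      obtain ⟨r', s', hr', hs', heq⟩ := exists_isUnit_away_of_elementDivisor_eq hu hr hs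
        fun Q hQ => by
          have := hE' c Q hQ
          rw [hrs, Finsupp.sub_apply] at this
          exact sub_eq_zero.1 this
      -- Up to a power of `u`, units of `A_u` are units of `A`; their divisors are multiples of
      -- the divisor of `u`.
      have hmul : ∀ y : A, IsUnit (algebraMap A (Localization.Away u) y) →
          y ≠ 0 ∧ ∃ z : ℤ, elementDivisor y = z • elementDivisor u := by
        intro y hy
        obtain ⟨b, k, m, hb, hbkm⟩ := hunits y hy
        have hy0 : y ≠ 0 := by
          rintro rfl
          rw [zero_mul, zero_eq_mul] at hbkm
          exact hbkm.elim hb.ne_zero (pow_ne_zero _ hu)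
        have h := congrArg elementDivisor hbkm
        rw [elementDivisor_mul hy0 (pow_ne_zero _ hu), elementDivisor_mul hb.ne_zero
          (pow_ne_zero _ hu), elementDivisor_of_isUnit hb, elementDivisor_pow hu,
          elementDivisor_pow hu, zero_add] at h
        refine ⟨hy0, (m : ℤ) - k, ?_⟩
        rw [sub_smul, natCast_zsmul, natCast_zsmul, ← h, add_sub_cancel_right]
      obtain ⟨hr0, z₁, hz₁⟩ := hmul r' hr'
      obtain ⟨hs0, z₂, hz₂⟩ := hmul s' hs'
      have h := congrArg elementDivisor heq
      rw [elementDivisor_mul hr hs0, elementDivisor_mul hs hr0, hz₁, hz₂] at h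
      refine ⟨z₁ - z₂, funext fun i => ?_⟩
      have h2 : E c = (z₁ - z₂) • E a := by
        rw [hrs, ← hEa, sub_smul, sub_eq_sub_iff_add_eq_add, h, add_comm]
      have h3 := congrArg (fun D => D (P i)) h2
      simp only [Finsupp.smul_apply, hE] at h3
      exact h3.symm
    · rw [AddSubgroup.zmultiples_le]
      refine (QuotientAddGroup.eq_zero_iff _).2 ?_
      rw [← hEa]
      exact elementDivisor_mem_range u
  exact ⟨((QuotientAddGroup.quotientAddEquivOfEq hker.symm).trans
    (QuotientAddGroup.quotientKerEquivOfSurjective Θ hsurj)).symm⟩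

end Nagata

/-! ### Normality from two charts -/

section Normal

variable {A : Type*} [CommRing A] [IsDomain A]

theorem exists_pow_mul_eq_algebraMap_of_isIntegral {u : A} (hu : u ≠ 0)
    [IsIntegrallyClosed (Localization.Away u)] {x : FractionRing A} (hx : IsIntegral A x) :
    ∃ (k : ℕ) (r : A),
      x * algebraMap A (FractionRing A) u ^ k = algebraMap A (FractionRing A) r := by
  have hle := powers_le_nonZeroDivisors_of_noZeroDivisors hu
  let : Algebra (Localization.Away u) (FractionRing A) :=
    IsLocalization.localizationAlgebraOfSubmonoidLe _ _ (.powers u) (nonZeroDivisors A) hle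
  have : IsScalarTower A (Localization.Away u) (FractionRing A) :=
    IsLocalization.localization_isScalarTower_of_submonoid_le _ _ (.powers u)
      (nonZeroDivisors A) hle
  have : IsFractionRing (Localization.Away u) (FractionRing A) :=
    IsFractionRing.isFractionRing_of_isDomain_of_isLocalization (.powers u) _ _
  obtain ⟨y, rfl⟩ := IsIntegrallyClosed.algebraMap_eq_of_integral
    (hx.tower_top (A := Localization.Away u))
  obtain ⟨k, r, hr⟩ := IsLocalization.Away.surj u y
  refine ⟨k, r, ?_⟩
  rw [IsScalarTower.algebraMap_apply A (Localization.Away u) (FractionRing A) r, ← hr, map_mul,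
    map_pow, ← IsScalarTower.algebraMap_apply]

theorem pow_dvd_of_pow_dvd_pow_mul {u v : A} (hu : u ≠ 0) (h : ∀ y : A, u ∣ v * y → u ∣ y)
    (k m : ℕ) (y : A) (hy : u ^ k ∣ v ^ m * y) : u ^ k ∣ y := by
  have hm : ∀ (m : ℕ) (y : A), u ∣ v ^ m * y → u ∣ y := by
    intro m
    induction m with
    | zero => simp
    | succ m ih => exact fun y hy => ih y (h _ (by rwa [← mul_assoc, ← pow_succ']))
  induction k generalizing y with
  | zero => simp
  | succ k ih =>
    obtain ⟨z, rfl⟩ := hm m y ((dvd_pow_self u k.succ_ne_zero).trans hy)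
    rw [pow_succ', mul_dvd_mul_iff_left hu]
    rw [pow_succ', mul_left_comm, mul_dvd_mul_iff_left hu] at hy
    exact ih z hy

/-- If `v` is a nonzerodivisor modulo `u` then `A = A_u ∩ A_v`, so `A` is integrally closed as soon
as `A_u` and `A_v` are. -/
theorem isIntegrallyClosed_of_away {u v : A} (hu : u ≠ 0) (hv : v ≠ 0)
    [IsIntegrallyClosed (Localization.Away u)] [IsIntegrallyClosed (Localization.Away v)]
    (h : ∀ y : A, u ∣ v * y → u ∣ y) : IsIntegrallyClosed A := by
  have hinj := IsFractionRing.injective A (FractionRing A)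
  refine (isIntegrallyClosed_iff (FractionRing A)).2 fun {x} hx => ?_
  obtain ⟨k, r, hr⟩ := exists_pow_mul_eq_algebraMap_of_isIntegral hu hx
  obtain ⟨m, s, hs⟩ := exists_pow_mul_eq_algebraMap_of_isIntegral hv hx
  have hrs : v ^ m * r = u ^ k * s := by
    apply hinj
    rw [map_mul, map_mul, ← hr, ← hs, map_pow, map_pow]
    ring
  obtain ⟨y, rfl⟩ := pow_dvd_of_pow_dvd_pow_mul hu h k m r ⟨s, hrs⟩
  refine ⟨y, ?_⟩
  have hu' : algebraMap A (FractionRing A) u ^ k ≠ 0 :=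
    pow_ne_zero _ ((map_ne_zero_iff _ hinj).2 hu)
  refine mul_right_cancel₀ hu' ?_
  rw [hr, map_mul, map_pow, mul_comm]

end Normal

/-! ### The algebra `R[u, v] / (u v - g)` -/

universe w

section Hyperbola

open Polynomial

/-- `A` is the `R`-algebra `R[u, v] / (u v - g)`, in the sense that `u` and `v` generate it, satisfy
`u v = g`, and can be sent to any two elements with product `g`. -/
structure IsHyperbola {R A : Type w} [CommRing R] [CommRing A] [Algebra R A] (g : R) (u v : A) :
    Prop where
  mul_eq : u * v = algebraMap R A g
  adjoin_eq_top : Algebra.adjoin R {u, v} = ⊤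
  exists_lift : ∀ (B : Type w) [CommRing B] [Algebra R B] (b c : B), b * c = algebraMap R B g →
    ∃ φ : A →ₐ[R] B, φ u = b ∧ φ v = c

namespace IsHyperbola

variable {R A : Type w} [CommRing R] [CommRing A] [Algebra R A] {g : R} {u v : A}

theorem symm (h : IsHyperbola g u v) : IsHyperbola g v u where
  mul_eq := by rw [mul_comm, h.mul_eq]
  adjoin_eq_top := by rw [Set.pair_comm, h.adjoin_eq_top]
  exists_lift B _ _ b c hbc := by
    obtain ⟨φ, h1, h2⟩ := h.exists_lift B c b (by rw [mul_comm, hbc])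
    exact ⟨φ, h2, h1⟩

theorem exists_pow_mul_eq_aeval (h : IsHyperbola g u v) (y : A) :
    ∃ (k : ℕ) (p : R[X]), y * u ^ k = aeval u p := by
  have hy : y ∈ Algebra.adjoin R {u, v} := h.adjoin_eq_top ▸ Algebra.mem_top
  induction hy using Algebra.adjoin_induction with
  | mem y hy =>
    rcases hy with rfl | rfl
    · exact ⟨0, X, by simp⟩
    · exact ⟨1, C g, by rw [aeval_C, ← h.mul_eq, pow_one, mul_comm]⟩
  | algebraMap r => exact ⟨0, C r, by simp⟩
  | add y z _ _ hy hz =>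
    obtain ⟨k, p, hp⟩ := hy
    obtain ⟨m, q, hq⟩ := hz
    refine ⟨k + m, p * X ^ m + q * X ^ k, ?_⟩
    simp only [map_add, map_mul, map_pow, aeval_X, ← hp, ← hq]
    ring
  | mul y z _ _ hy hz =>
    obtain ⟨k, p, hp⟩ := hy
    obtain ⟨m, q, hq⟩ := hz
    refine ⟨k + m, p * q, ?_⟩
    simp only [map_mul, ← hp, ← hq]
    ring

theorem exists_eq_mul_add_aeval (h : IsHyperbola g u v) (y : A) :
    ∃ (z : A) (p : R[X]), y = u * z + aeval v p := by
  have hy : y ∈ Algebra.adjoin R {u, v} := h.adjoin_eq_top ▸ Algebra.mem_top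
  induction hy using Algebra.adjoin_induction with
  | mem y hy =>
    rcases hy with rfl | rfl
    · exact ⟨1, 0, by simp⟩
    · exact ⟨0, X, by simp⟩
  | algebraMap r => exact ⟨0, C r, by simp⟩
  | add y z _ _ hy hz =>
    obtain ⟨y', p, hp⟩ := hy
    obtain ⟨z', q, hq⟩ := hz
    refine ⟨y' + z', p + q, ?_⟩
    rw [hp, hq, map_add]
    ring
  | mul y z _ _ hy hz =>
    obtain ⟨y', p, hp⟩ := hy
    obtain ⟨z', q, hq⟩ := hz
    refine ⟨y' * (u * z' + aeval v q) + aeval v p * z', p * q, ?_⟩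
    rw [hp, hq, map_mul]
    ring

/-- For a divisor `d` of `g`, the quotient of `A` by `(u, d)` is `(R/d)[v]`. -/
theorem exists_algHom_quotient (h : IsHyperbola g u v) {d : R} (hd : d ∣ g) :
    ∃ χ : A →ₐ[R] (R ⧸ Ideal.span {d})[X], χ u = 0 ∧ χ v = X ∧
      ∀ y, χ y = 0 ↔ ∃ b c, y = u * b + algebraMap R A d * c := by
  have hC : ∀ r : R, algebraMap R (R ⧸ Ideal.span {d})[X] r = C (Ideal.Quotient.mk _ r) :=
    fun r => rfl
  obtain ⟨χ, hu, hv⟩ := h.exists_lift (R ⧸ Ideal.span {d})[X] 0 X (by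
    rw [zero_mul, hC, Ideal.Quotient.eq_zero_iff_mem.2 (Ideal.mem_span_singleton.2 hd), C_0])
  refine ⟨χ, hu, hv, fun y => ⟨fun hy => ?_, ?_⟩⟩
  · obtain ⟨b, p, rfl⟩ := h.exists_eq_mul_add_aeval y
    rw [map_add, map_mul, hu, zero_mul, zero_add, ← aeval_algHom_apply, hv] at hy
    have hp : C d ∣ p := by
      rw [C_dvd_iff_dvd_coeff]
      intro i
      have hmap : aeval (X : (R ⧸ Ideal.span {d})[X]) p = p.map (Ideal.Quotient.mk _) := rfl
      rw [← Ideal.mem_span_singleton, ← Ideal.Quotient.eq_zero_iff_mem, ← coeff_map, ← hmap, hy,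
        coeff_zero]
    obtain ⟨q, rfl⟩ := hp
    exact ⟨b, aeval v q, by rw [map_mul, aeval_C]⟩
  · rintro ⟨b, c, rfl⟩
    rw [map_add, map_mul, hu, zero_mul, zero_add, map_mul, AlgHom.commutes, hC,
      Ideal.Quotient.eq_zero_iff_mem.2 (Ideal.mem_span_singleton_self d), C_0, zero_mul]

theorem dvd_of_dvd_mul (h : IsHyperbola g u v) (y : A) (hy : u ∣ v * y) : u ∣ y := by
  obtain ⟨χ, hu, hv, hχ⟩ := h.exists_algHom_quotient (dvd_refl g)
  have h0 : χ y = 0 := by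
    obtain ⟨z, hz⟩ := hy
    have h1 := congrArg χ hz
    rw [map_mul, map_mul, hu, hv, zero_mul, ← mul_zero X] at h1
    exact isRegular_X.left h1
  obtain ⟨b, c, rfl⟩ := (hχ y).1 h0
  rw [← h.mul_eq]
  exact ⟨b + v * c, by ring⟩

/-- `A` maps to the rational functions in one variable over `R`, with `u` sent to the variable. -/
theorem exists_algHom_fractionRing [IsDomain R] (h : IsHyperbola g u v) :
    ∃ φ : A →ₐ[R] FractionRing R[X],
      ∀ p : R[X], φ (aeval u p) = algebraMap R[X] (FractionRing R[X]) p := by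
  have hX : algebraMap R[X] (FractionRing R[X]) X ≠ 0 :=
    (map_ne_zero_iff _ (IsFractionRing.injective _ _)).2 X_ne_zero
  obtain ⟨φ, hu, -⟩ := h.exists_lift (FractionRing R[X]) (algebraMap R[X] _ X)
    (algebraMap R _ g / algebraMap R[X] _ X) (mul_div_cancel₀ _ hX)
  refine ⟨φ, fun p => ?_⟩
  rw [← aeval_algHom_apply, hu, aeval_algebraMap_apply, aeval_X_left_apply]

theorem aeval_injective [IsDomain R] (h : IsHyperbola g u v) :
    Function.Injective (aeval u : R[X] →ₐ[R] A) := by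
  obtain ⟨φ, hφ⟩ := h.exists_algHom_fractionRing
  refine Function.Injective.of_comp (f := φ) fun p q hpq => ?_
  refine IsFractionRing.injective R[X] (FractionRing R[X]) ?_
  rw [← hφ, ← hφ]
  exact hpq

theorem ne_zero [IsDomain R] (h : IsHyperbola g u v) : u ≠ 0 := by
  intro h0
  have h1 : (aeval u : R[X] →ₐ[R] A) X = aeval u (0 : R[X]) := by rw [aeval_X, map_zero, h0]
  exact X_ne_zero (R := R) (h.aeval_injective h1)

theorem isDomain [IsDomain R] (h : IsHyperbola g u v) (hu : ∀ y, u * y = 0 → y = 0) :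
    IsDomain A := by
  obtain ⟨φ, hφ⟩ := h.exists_algHom_fractionRing
  refine Function.Injective.isDomain φ.toRingHom ((injective_iff_map_eq_zero _).2 fun y hy => ?_)
  obtain ⟨k, p, hp⟩ := h.exists_pow_mul_eq_aeval y
  have hy : φ y = 0 := hy
  have h1 := congrArg φ hp
  rw [map_mul, hy, zero_mul, hφ, eq_comm,
    map_eq_zero_iff _ (IsFractionRing.injective R[X] (FractionRing R[X]))] at h1
  rw [h1, map_zero] at hp
  clear h1
  induction k with
  | zero => simpa using hp
  | succ k ih => exact ih (hu _ (by rw [← hp]; ring))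

/-- Inverting `u` in `A` gives the ring of Laurent polynomials in `u` over `R`. -/
theorem isLocalization_away [IsDomain R] [IsDomain A] (h : IsHyperbola g u v) :
    letI : Algebra R[X] (Localization.Away u) :=
      ((algebraMap A (Localization.Away u)).comp (aeval u : R[X] →ₐ[R] A).toRingHom).toAlgebra
    IsLocalization.Away (X : R[X]) (Localization.Away u) := by
  let : Algebra R[X] (Localization.Away u) :=
      ((algebraMap A (Localization.Away u)).comp (aeval u : R[X] →ₐ[R] A).toRingHom).toAlgebra
  have hmap : ∀ p : R[X], algebraMap R[X] (Localization.Away u) p =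
      algebraMap A (Localization.Away u) (aeval u p) := fun p => rfl
  refine IsLocalization.Away.mk X ?_ (fun s => ?_) fun p q hpq => ⟨0, ?_⟩
  · rw [hmap, aeval_X]
    exact IsLocalization.Away.algebraMap_isUnit u
  · obtain ⟨n, y, hy⟩ := IsLocalization.Away.surj u s
    obtain ⟨k, p, hp⟩ := h.exists_pow_mul_eq_aeval y
    refine ⟨n + k, p, ?_⟩
    rw [hmap, hmap, aeval_X, ← hp, map_mul, ← hy, map_pow, pow_add, mul_assoc]
  · rw [hmap, hmap] at hpq
    rw [h.aeval_injective (algebraMap_away_injective h.ne_zero hpq)]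

theorem uniqueFactorizationMonoid_away [IsDomain R] [UniqueFactorizationMonoid R] [IsDomain A]
    (h : IsHyperbola g u v) : UniqueFactorizationMonoid (Localization.Away u) := by
  let : Algebra R[X] (Localization.Away u) :=
      ((algebraMap A (Localization.Away u)).comp (aeval u : R[X] →ₐ[R] A).toRingHom).toAlgebra
  have : IsLocalization.Away (X : R[X]) (Localization.Away u) := h.isLocalization_away
  exact .of_isLocalization (.powers (X : R[X])) _

theorem isIntegrallyClosed_away [IsDomain R] [UniqueFactorizationMonoid R] [IsDomain A]
    (h : IsHyperbola g u v) : IsIntegrallyClosed (Localization.Away u) := by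
  let : Algebra R[X] (Localization.Away u) :=
      ((algebraMap A (Localization.Away u)).comp (aeval u : R[X] →ₐ[R] A).toRingHom).toAlgebra
  have : IsLocalization.Away (X : R[X]) (Localization.Away u) := h.isLocalization_away
  exact isIntegrallyClosed_of_isLocalization _ (.powers (X : R[X]))
    (powers_le_nonZeroDivisors_of_noZeroDivisors X_ne_zero)

theorem isIntegrallyClosed [IsDomain R] [UniqueFactorizationMonoid R] [IsDomain A]
    (h : IsHyperbola g u v) : IsIntegrallyClosed A := by
  have := h.isIntegrallyClosed_away
  have := h.symm.isIntegrallyClosed_away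
  exact isIntegrallyClosed_of_away h.ne_zero h.symm.ne_zero h.dvd_of_dvd_mul

/-- Units of the Laurent polynomial ring are monomials whose coefficient is a unit. -/
theorem exists_isUnit_mul_pow [IsDomain R] [IsDomain A] (h : IsHyperbola g u v) (y : A)
    (hy : IsUnit (algebraMap A (Localization.Away u) y)) :
    ∃ (c : A) (k m : ℕ), IsUnit c ∧ y * u ^ k = c * u ^ m := by
  obtain ⟨n, z, hz⟩ := (IsLocalization.Away.algebraMap_isUnit_iff u).1 hy
  obtain ⟨k, p, hp⟩ := h.exists_pow_mul_eq_aeval y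
  obtain ⟨m, q, hq⟩ := h.exists_pow_mul_eq_aeval z
  have hpq : p * q = X ^ (n + k + m) := by
    apply h.aeval_injective
    rw [map_mul, ← hp, ← hq, map_pow, aeval_X, pow_add, pow_add, hz]
    ring
  obtain ⟨i, -, hi⟩ := (dvd_prime_pow prime_X _).1 (Dvd.intro q hpq)
  obtain ⟨c, hc⟩ := hi.symm
  refine ⟨aeval u (c : R[X]), k, i, c.isUnit.map _, ?_⟩
  rw [hp, ← hc, map_mul, map_pow, aeval_X, mul_comm]

end IsHyperbola

end Hyperbola

/-! ### The height one primes containing `u` -/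

namespace IsHyperbola

variable {R A : Type w} [CommRing R] [CommRing A] [Algebra R A] {u v : A}
variable [IsDomain R]
variable {ι : Type*} [Fintype ι] {f : ι → R} {a : ι → ℕ}

/-- For each prime factor `f i` of `g`, the ideal `(u, f i)` is a height one prime of `A`. -/
theorem exists_heightOnePrime [IsDomain A] [IsNoetherianRing A]
    (h : IsHyperbola (∏ i, f i ^ a i) u v) (hf : ∀ i, Prime (f i))
    (hcop : ∀ i j, f i ∣ f j → i = j) (ha : ∀ i, 1 ≤ a i) (i : ι) :
    ∃ P : HeightOnePrime A, v ∉ P.1.asIdeal ∧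
      (∀ r : R, algebraMap R A r ∈ P.1.asIdeal ↔ f i ∣ r) ∧
      ∀ y, y ∈ P.1.asIdeal ↔ ∃ b c, y = u * b + algebraMap R A (f i) * c := by
  have hdvd : f i ∣ ∏ i, f i ^ a i :=
    (dvd_pow_self _ (Nat.one_le_iff_ne_zero.1 (ha i))).trans (Finset.dvd_prod_of_mem _ (by simp))
  obtain ⟨χ, hu, hv, hχ⟩ := h.exists_algHom_quotient hdvd
  have hprime : (Ideal.span {f i}).IsPrime :=
    (Ideal.span_singleton_prime (hf i).ne_zero).2 (hf i)
  have hker : (RingHom.ker χ.toRingHom).IsPrime := RingHom.ker_isPrime _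
  have hmemu : u ∈ RingHom.ker χ.toRingHom := hu
  have halg : ∀ r : R, algebraMap R A r ∈ RingHom.ker χ.toRingHom ↔ f i ∣ r := by
    intro r
    change χ (algebraMap R A r) = 0 ↔ _
    rw [AlgHom.commutes, ← Ideal.mem_span_singleton, ← Ideal.Quotient.eq_zero_iff_mem]
    exact Polynomial.C_eq_zero
  have hheight : (RingHom.ker χ.toRingHom).height = 1 := by
    refine le_antisymm ?_ ?_
    · refine Ideal.height_le_one_of_isPrincipal_of_mem_minimalPrimes (Ideal.span {u}) _
        ⟨⟨hker, (Ideal.span_singleton_le_iff_mem _).2 hmemu⟩, fun q hq hle y hy => ?_⟩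
      -- A prime `q ∋ u` contains some `f j`; inside `(u, f i)` this forces `j = i`.
      have huq : u ∈ q := (Ideal.span_singleton_le_iff_mem _).1 hq.2
      have hgq : algebraMap R A (∏ i, f i ^ a i) ∈ q := by
        rw [← h.mul_eq]
        exact q.mul_mem_right _ huq
      rw [map_prod] at hgq
      have := hq.1
      obtain ⟨j, -, hj⟩ := (Ideal.IsPrime.prod_mem_iff).1 hgq
      rw [map_pow] at hj
      have hj := hq.1.mem_of_pow_mem _ hj
      obtain rfl := hcop i j ((halg _).1 (hle hj))
      obtain ⟨b, c, rfl⟩ := (hχ y).1 hy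
      exact add_mem (q.mul_mem_right _ huq) (q.mul_mem_right _ hj)
    · rw [Order.one_le_iff_pos, pos_iff_ne_zero, ne_eq, Ideal.height_eq_zero_iff_eq_bot]
      intro hbot
      rw [hbot] at hmemu
      exact h.ne_zero hmemu
  refine ⟨⟨⟨_, hker⟩, hheight⟩, fun hmem => ?_, halg, hχ⟩
  have h0 : χ v = 0 := hmem
  exact Polynomial.X_ne_zero (hv.symm.trans h0)

theorem nonempty_divisorClassGroup_equiv [UniqueFactorizationMonoid R]
    [IsDomain A] [IsNoetherianRing A] [IsIntegrallyClosed A]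
    (h : IsHyperbola (∏ i, f i ^ a i) u v) (hf : ∀ i, Prime (f i))
    (hcop : ∀ i j, f i ∣ f j → i = j) (ha : ∀ i, 1 ≤ a i) :
    Nonempty (DivisorClassGroup A ≃+
      ((ι → ℤ) ⧸ AddSubgroup.zmultiples (fun i => (a i : ℤ)))) := by
  choose P hvP halg hmem using h.exists_heightOnePrime hf hcop ha
  have hu : u ≠ 0 := h.ne_zero
  have hv : v ≠ 0 := h.symm.ne_zero
  have huP : ∀ i, u ∈ (P i).1.asIdeal := fun i => (hmem i u).2 ⟨1, 0, by simp⟩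
  have hfP : ∀ i, algebraMap R A (f i) ∈ (P i).1.asIdeal := fun i => (halg i _).2 (dvd_refl _)
  have hfne : ∀ i, algebraMap R A (f i) ≠ 0 := by
    intro i h0
    have h1 : Polynomial.aeval u (Polynomial.C (f i)) = Polynomial.aeval u (0 : Polynomial R) := by
      rw [Polynomial.aeval_C, h0, map_zero]
    exact (hf i).ne_zero (Polynomial.C_eq_zero.1 (h.aeval_injective h1))
  have hprod : u * v = ∏ i, algebraMap R A (f i) ^ a i := by
    rw [h.mul_eq, map_prod]
    exact Finset.prod_congr rfl fun i _ => map_pow _ _ _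
  have := h.uniqueFactorizationMonoid_away
  refine nonempty_divisorClassGroup_equiv_of_away hu h.exists_isUnit_mul_pow (P := P)
    (fun i j hij => ?_) (fun Q => ⟨fun hQ => ?_, ?_⟩) fun i => ?_
  · exact hcop i j ((halg i _).1 (hij ▸ hfP j))
  · have hprodQ : ∏ i, algebraMap R A (f i) ^ a i ∈ Q.1.asIdeal := by
      rw [← hprod]
      exact Q.1.asIdeal.mul_mem_right _ hQ
    obtain ⟨i, -, hi⟩ := (Ideal.IsPrime.prod_mem_iff).1 hprodQ
    have hi := Q.1.2.mem_of_pow_mem _ hi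
    refine ⟨i, HeightOnePrime.eq_of_le fun y hy => ?_⟩
    obtain ⟨b, c, rfl⟩ := (hmem i y).1 hy
    exact add_mem (Q.1.asIdeal.mul_mem_right _ hQ) (Q.1.asIdeal.mul_mem_right _ hi)
  · rintro ⟨i, rfl⟩
    exact huP i
  -- Compare the orders of both sides of `u v = ∏ f j ^ a j` along `(u, f i)`, where `f i` is a
  -- uniformiser while `v` and the other `f j` are units.
  · have hone : elementDivisor (algebraMap R A (f i)) (P i) = 1 := by
      refine elementDivisor_apply_eq_one (hfne i) (hfP i) fun y hy => ⟨v, hvP i, ?_⟩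
      obtain ⟨b, c, rfl⟩ := (hmem i y).1 hy
      have hdvd : algebraMap R A (f i) ∣ u * v := by
        rw [hprod]
        exact (dvd_pow_self _ (Nat.one_le_iff_ne_zero.1 (ha i))).trans
          (Finset.dvd_prod_of_mem (fun i => algebraMap R A (f i) ^ a i) (Finset.mem_univ i))
      have heq : v * (u * b + algebraMap R A (f i) * c) =
          u * v * b + algebraMap R A (f i) * (v * c) := by ring
      rw [heq]
      exact dvd_add (hdvd.mul_right _) (dvd_mul_right _ _)
    have hdiv := congrArg (fun D => D (P i)) (congrArg elementDivisor hprod)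
    rw [elementDivisor_mul hu hv, elementDivisor_prod _ _ fun j _ => pow_ne_zero _ (hfne j),
      Finsupp.add_apply, elementDivisor_apply_eq_zero (hvP i), add_zero,
      Finsupp.finsetSum_apply, Finset.sum_eq_single i, elementDivisor_pow (hfne i),
      Finsupp.smul_apply, hone] at hdiv
    · simpa using hdiv
    · intro j _ hj
      rw [elementDivisor_pow (hfne j), Finsupp.smul_apply, elementDivisor_apply_eq_zero, smul_zero]
      exact fun hmem' => hj (hcop i j ((halg i _).1 hmem')).symm
    · simp

end IsHyperbola

/-! ### The hypersurface ring -/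

section Hypersurface

open MvPolynomial

theorem X_dvd_of_X_dvd_mul_hypersurface {n : ℕ} {g : MvPolynomial (Fin n) ℂ} (hg : g ≠ 0)
    {q : MvPolynomial (Fin 2 ⊕ Fin n) ℂ}
    (hq : X (Sum.inl 0) ∣ (X (Sum.inl 0) * X (Sum.inl 1) - rename Sum.inr g) * q) :
    X (Sum.inl 0) ∣ q := by
  refine (X_prime.dvd_or_dvd hq).resolve_left fun hdvd => hg ?_
  have h1 : X (Sum.inl 0) ∣ (rename Sum.inr g : MvPolynomial (Fin 2 ⊕ Fin n) ℂ) :=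
    (dvd_sub_right (dvd_mul_right _ _)).1 hdvd
  have h2 := map_dvd (aeval (Sum.elim (fun _ => 0) X) :
    MvPolynomial (Fin 2 ⊕ Fin n) ℂ →ₐ[ℂ] MvPolynomial (Fin n) ℂ) h1
  rw [aeval_X, Sum.elim_inl, zero_dvd_iff, aeval_rename, Sum.elim_comp_inr,
    aeval_X_left_apply] at h2
  exact h2

/-- The coefficient ring `ℂ[x₁, …, xₙ]` mapped to the hypersurface ring. -/
noncomputable abbrev hypersurfaceAlgebra (n t : ℕ) (f : Fin t → MvPolynomial (Fin n) ℂ)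
    (a : Fin t → ℕ) : Algebra (MvPolynomial (Fin n) ℂ) (HypersurfaceRing n t f a) :=
  ((Ideal.Quotient.mk _).comp (rename Sum.inr :
    MvPolynomial (Fin n) ℂ →ₐ[ℂ] MvPolynomial (Fin 2 ⊕ Fin n) ℂ).toRingHom).toAlgebra

theorem isHyperbola_hypersurfaceRing (n t : ℕ) (f : Fin t → MvPolynomial (Fin n) ℂ)
    (a : Fin t → ℕ) :
    letI := hypersurfaceAlgebra n t f a
    IsHyperbola (A := HypersurfaceRing n t f a) (∏ i, f i ^ a i)
      (Ideal.Quotient.mk _ (X (Sum.inl 0))) (Ideal.Quotient.mk _ (X (Sum.inl 1))) := by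
  let := hypersurfaceAlgebra n t f a
  have halg : ∀ r, algebraMap (MvPolynomial (Fin n) ℂ) (HypersurfaceRing n t f a) r =
      Ideal.Quotient.mk _ (rename Sum.inr r) := fun r => rfl
  refine ⟨?_, ?_, fun B _ _ b c hbc => ?_⟩
  · rw [halg, ← map_mul]
    exact Ideal.Quotient.eq.2 (Ideal.mem_span_singleton_self _)
  · rw [eq_top_iff]
    rintro y -
    obtain ⟨p, rfl⟩ := Ideal.Quotient.mk_surjective y
    induction p using MvPolynomial.induction_on with
    | C z =>
      have : (C z : MvPolynomial (Fin 2 ⊕ Fin n) ℂ) = rename Sum.inr (C z) := (rename_C _ _).symm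
      rw [this, ← halg]
      exact Subalgebra.algebraMap_mem _ _
    | add p q hp hq =>
      rw [map_add]
      exact add_mem hp hq
    | mul_X p i hp =>
      rw [map_mul]
      refine mul_mem hp ?_
      rcases i with i | i
      · refine Algebra.subset_adjoin ?_
        fin_cases i
        · exact Or.inl rfl
        · exact Or.inr rfl
      · have : (X (Sum.inr i) : MvPolynomial (Fin 2 ⊕ Fin n) ℂ) = rename Sum.inr (X i) :=
          (rename_X _ _).symm
        rw [this, ← halg]
        exact Subalgebra.algebraMap_mem _ _
  · let φ : MvPolynomial (Fin 2 ⊕ Fin n) ℂ →+* B :=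
      eval₂Hom ((algebraMap (MvPolynomial (Fin n) ℂ) B).comp C)
        (Sum.elim ![b, c] fun i => algebraMap (MvPolynomial (Fin n) ℂ) B (X i))
    have hφ : ∀ r, φ (rename Sum.inr r) = algebraMap (MvPolynomial (Fin n) ℂ) B r := by
      intro r
      induction r using MvPolynomial.induction_on with
      | C z => simp [φ]
      | add p q hp hq => rw [map_add, map_add, map_add, hp, hq]
      | mul_X p i hp => rw [map_mul, map_mul, map_mul, hp, rename_X]; simp [φ]
    refine ⟨{ toRingHom := Ideal.Quotient.lift _ φ fun p hp => ?_, commutes' := hφ }, ?_, ?_⟩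
    · obtain ⟨q, rfl⟩ := Ideal.mem_span_singleton.1 hp
      rw [map_mul, map_sub, hφ, ← hbc, map_mul]
      simp [φ]
    · change φ (X (Sum.inl 0)) = b
      simp [φ]
    · change φ (X (Sum.inl 1)) = c
      simp [φ]

end Hypersurface

theorem mainTheorem4 (n t : ℕ) (f : Fin t → MvPolynomial (Fin n) ℂ) (a : Fin t → ℕ)
    (hf : ∀ i, Irreducible (f i))
    (hcop : ∀ i j, i ≠ j → IsRelPrime (f i) (f j))
    (ha : ∀ i, 1 ≤ a i) :
    ∃ (_ : IsDomain (HypersurfaceRing n t f a))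
      (_ : IsIntegrallyClosed (HypersurfaceRing n t f a)),
      Nonempty (DivisorClassGroup (HypersurfaceRing n t f a) ≃+
        ((Fin t → ℤ) ⧸ AddSubgroup.zmultiples (fun i => (a i : ℤ)))) := by
  let := hypersurfaceAlgebra n t f a
  have h := isHyperbola_hypersurfaceRing n t f a
  have hg : ∏ i, f i ^ a i ≠ 0 :=
    Finset.prod_ne_zero_iff.2 fun i _ => pow_ne_zero _ (hf i).ne_zero
  have hdom : IsDomain (HypersurfaceRing n t f a) := by
    refine h.isDomain fun y hy => ?_
    obtain ⟨p, rfl⟩ := Ideal.Quotient.mk_surjective y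
    rw [← map_mul, Ideal.Quotient.eq_zero_iff_mem, Ideal.mem_span_singleton] at hy
    obtain ⟨q, hq⟩ := hy
    -- The variable `u` divides `(u v - g) q`, hence `q`, and can be cancelled.
    obtain ⟨q', rfl⟩ := X_dvd_of_X_dvd_mul_hypersurface hg (Dvd.intro p hq)
    rw [Ideal.Quotient.eq_zero_iff_mem, Ideal.mem_span_singleton]
    exact ⟨q', mul_left_cancel₀ (MvPolynomial.X_ne_zero _) (hq.trans (mul_left_comm _ _ _))⟩
  have hic : IsIntegrallyClosed (HypersurfaceRing n t f a) := h.isIntegrallyClosed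
  refine ⟨hdom, hic, h.nonempty_divisorClassGroup_equiv (fun i => (hf i).prime) ?_ ha⟩
  intro i j hij
  by_contra hne
  exact (hf i).not_isUnit (hcop i j hne dvd_rfl hij)
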